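/- **Quantum randomization criterion.** Let $\mathcal H$ and $\mathcal K$ be separable complex Hilbert spaces, $\mathcal K\neq\{0\}$. For a Hilbert space $\mathcal G$ let $\mathcal S_1(\mathcal G)$ denote the space of trace class operators on $\mathcal G$, with trace norm $\|X\|_1=\mathrm{tr}\,|X|$. Let $Ch(\mathcal G,\mathcal G')$ denote the set of completely positive trace preserving (CPTP) linear maps $\Lambda:\mathcal S_1(\mathcal G)\to\mathcal S_1(\mathcal G')$; complete positivity means that $\Lambda\otimes \mathbf I_n$ is positive for every $n$, where $\mathbf I_n$ is the identity map of $\mathcal B(\mathbb C^n)$. Let $\Theta$ be an arbitrary set, let $\mathcal E=(\mathcal H,\{\rho_\theta\}_{\theta\in\Theta})$ and $\mathcal F=(\mathcal K,\{\sigma_\theta\}_{\theta\in\Theta})$ be quantum experiments, i.e. families of states ($\rho_\theta\in\mathcal S_1(\mathcal H)$, $\rho_\theta\ge0$, $\mathrm{tr}\,\rho_\theta=1$; likewise $\sigma_\theta$ on $\mathcal K$), and let $e:\Theta\to[0,\infty)$ be a function. A loss function on a quantum decision space $\mathcal H_D$ is a family of functions $\mathsf L_\theta:\mathcal S_1(\mathcal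 H_D)\to\mathbb R$, $\theta\in\Theta$, such that $\mathsf L_\theta(X)\ge0$ for $X\ge0$ and $|\mathsf L_\theta(X)-\mathsf L_\theta(Y)|\le\|X-Y\|_1$ for all $X,Y\ge0$ with $\mathrm{tr}\,X\le1$ and $\mathrm{tr}\,Y\le1$. One says that $\mathcal E$ is q-$e$-deficient relative to $\mathcal F$, written $\mathcal E\ge^q_e\mathcal F$, if for every infinite-dimensional separable Hilbert space $\mathcal H_D$, every loss function $\mathsf L$ on $\mathcal H_D$ and every $D\in Ch(\mathcal K,\mathcal H_D)$, $$\inf_{D'\in Ch(\mathcal H,\mathcal H_D)}\ \sup_{\theta\in\Theta}\bigl\{\mathsf L_\theta(D'(\rho_\theta))-\mathsf L_\theta(D(\sigma_\theta))-e_\theta\bigr\}\le0 .$$ Then $\mathcal E\ge^q_e\mathcal F$ if and only if there is a CPTP map $\Lambda:\mathcal S_1(\mathcal H)\to\mathcal S_1(\mathcal K)$ with $$\|\Lambda(\rho_\theta)-\sigma_\theta\|_1\le e_\theta\qquad\text{for all }\theta\in\Theta .$$ -/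

import Mathlib

open scoped InnerProductSpace ENNReal ComplexOrder

universe t u v w

namespace QStat

section TraceClass

variable {H : Type*} [NormedAddCommGroup H] [InnerProductSpace ℂ H] [CompleteSpace H]

/-- The index set of a fixed Hilbert (complete orthonormal) basis of `H`. -/
noncomputable def basisIndex (H : Type*) [NormedAddCommGroup H] [InnerProductSpace ℂ H]
    [CompleteSpace H] : Set H :=
  (exists_hilbertBasis ℂ H).choose

/-- A fixed Hilbert (complete orthonormal) basis of `H`. -/
noncomputable def basis (H : Type*) [NormedAddCommGroup H] [InnerProductSpace ℂ H]
    [CompleteSpace H] : HilbertBasis (basisIndex H) ℂ H :=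
  (exists_hilbertBasis ℂ H).choose_spec.choose

/-- The trace norm `‖T‖₁ = tr |T|`, where `|T| = √(T† T)`, as an element of `[0, ∞]`. -/
noncomputable def eTraceNorm (T : H →L[ℂ] H) : ℝ≥0∞ :=
  ∑' i, ENNReal.ofReal (⟪basis H i, CFC.abs T (basis H i)⟫_ℂ).re

/-- The squared Hilbert-Schmidt norm (auxiliary). -/
noncomputable def hsSq (A : H →L[ℂ] H) : ℝ≥0∞ :=
  ∑' i, ENNReal.ofReal (‖A (basis H i)‖ ^ 2)

theorem parseval (x : H) :
    ENNReal.ofReal (‖x‖ ^ 2) = ∑' i, ENNReal.ofReal (‖⟪basis H i, x⟫_ℂ‖ ^ 2) := by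
  have h := (basis H).hasSum_inner_mul_inner x x
  have h2 : HasSum (fun i => ‖⟪basis H i, x⟫_ℂ‖ ^ 2) (‖x‖ ^ 2) := by
    have h3 := Complex.hasSum_re h
    have e : (⟪x, x⟫_ℂ).re = ‖x‖ ^ 2 := by
      rw [inner_self_eq_norm_sq_to_K]; norm_cast
    rw [e] at h3
    refine h3.congr_fun ?_
    intro i
    rw [← inner_conj_symm x (basis H i), mul_comm, Complex.mul_conj, Complex.normSq_eq_norm_sq]
    norm_cast
  rw [← h2.tsum_eq, ENNReal.ofReal_tsum_of_nonneg (fun i => sq_nonneg _) h2.summable]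

theorem hsSq_adjoint (A : H →L[ℂ] H) : hsSq (star A) = hsSq A := by
  unfold hsSq
  rw [tsum_congr fun i => parseval (star A (basis H i)), tsum_congr fun i => parseval (A (basis H i))]
  rw [ENNReal.tsum_comm]
  refine tsum_congr fun i => tsum_congr fun j => ?_
  rw [ContinuousLinearMap.star_eq_adjoint, ContinuousLinearMap.adjoint_inner_right,
    norm_inner_symm]

theorem hsSq_mul_le (B A : H →L[ℂ] H) (hB : ‖B‖ ≤ 1) : hsSq (B * A) ≤ hsSq A := by
  refine ENNReal.tsum_le_tsum fun i => ENNReal.ofReal_le_ofReal ?_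
  have : ‖B (A (basis H i))‖ ≤ ‖A (basis H i)‖ := by
    simpa using B.le_of_opNorm_le hB (A (basis H i))
  exact pow_le_pow_left₀ (norm_nonneg _) this 2

theorem norm_abs_apply (T : H →L[ℂ] H) (x : H) : ‖CFC.abs T x‖ = ‖T x‖ := by
  have hs : star (CFC.abs T) = CFC.abs T := (CFC.abs_nonneg T).isSelfAdjoint.star_eq
  have h : ⟪CFC.abs T x, CFC.abs T x⟫_ℂ = ⟪T x, T x⟫_ℂ := by
    rw [← ContinuousLinearMap.adjoint_inner_right, ← ContinuousLinearMap.star_eq_adjoint, hs,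
      ← mul_apply_eq_comp, CFC.abs_mul_abs, mul_apply_eq_comp,
      ContinuousLinearMap.star_eq_adjoint, ContinuousLinearMap.adjoint_inner_right]
  rw [@norm_eq_sqrt_re_inner ℂ, @norm_eq_sqrt_re_inner ℂ _ _ _ _ (T x), h]

theorem exists_factor (T P : H →L[ℂ] H) (h : ∀ x, ‖T x‖ ≤ ‖P x‖) :
    ∃ W : H →L[ℂ] H, ‖W‖ ≤ 1 ∧ T = W * P := by
  let M := (LinearMap.range (P : H →ₗ[ℂ] H)).topologicalClosure
  let e : H →ₗ[ℂ] M := (P : H →ₗ[ℂ] H).codRestrict M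
    (fun x => Submodule.le_topologicalClosure _ ⟨x, rfl⟩)
  have hd : DenseRange e := by
    rw [DenseRange, dense_iff_closure_eq, Set.eq_univ_iff_forall]
    rintro ⟨y, hy⟩
    rw [closure_subtype]
    have : (Subtype.val '' Set.range e) = Set.range P := by
      rw [← Set.range_comp]; rfl
    rw [this]
    exact hy
  have hb : ∀ x, ‖(T : H →ₗ[ℂ] H) x‖ ≤ 1 * ‖e x‖ := by
    intro x; rw [one_mul]; exact h x
  have : CompleteSpace M := (Submodule.isClosed_topologicalClosure _).completeSpace_coe
  refine ⟨((T : H →ₗ[ℂ] H).extendOfNorm e) ∘L M.orthogonalProjectionOnto, ?_, ?_⟩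
  · refine ContinuousLinearMap.opNorm_le_bound _ zero_le_one fun x => ?_
    refine (LinearMap.norm_extendOfNorm_apply_le hd 1 hb _).trans ?_
    rw [one_mul, one_mul]
    exact M.norm_orthogonalProjectionOnto_apply_le x
  · ext x
    have h1 : M.orthogonalProjectionOnto (P x) = e x :=
      M.orthogonalProjectionOnto_mem_subspace_eq_self (e x)
    rw [mul_apply_eq_comp, ContinuousLinearMap.comp_apply, h1,
      LinearMap.extendOfNorm_eq hd ⟨1, hb⟩]
    rfl

theorem eTraceNorm_eq_hsSq (T : H →L[ℂ] H) : eTraceNorm T = hsSq (CFC.sqrt (CFC.abs T)) := by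
  refine tsum_congr fun i => ?_
  have hs : star (CFC.sqrt (CFC.abs T)) = CFC.sqrt (CFC.abs T) :=
    (CFC.sqrt_nonneg (CFC.abs T)).isSelfAdjoint.star_eq
  have h := CFC.sqrt_mul_sqrt_self (CFC.abs T) (CFC.abs_nonneg T)
  congr 1
  conv_lhs => rw [← h]
  conv_lhs => rw [mul_apply_eq_comp, ← hs, ContinuousLinearMap.star_eq_adjoint,
    ContinuousLinearMap.adjoint_inner_right, ← ContinuousLinearMap.star_eq_adjoint, hs]
  rw [inner_self_eq_norm_sq_to_K]; norm_cast

theorem eTraceNorm_add_le (S T : H →L[ℂ] H) :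
    eTraceNorm (S + T) ≤ eTraceNorm S + eTraceNorm T := by
  obtain ⟨W, hW, hWe⟩ := exists_factor (CFC.abs (S + T)) (S + T) fun x => (norm_abs_apply _ x).le
  have key : ∀ R : H →L[ℂ] H, ∃ A : H →L[ℂ] H,
      hsSq A ≤ eTraceNorm R ∧ W * R = star A * CFC.sqrt (CFC.abs R) := by
    intro R
    obtain ⟨U, hU, hUe⟩ := exists_factor R (CFC.abs R) fun x => (norm_abs_apply _ x).ge
    refine ⟨star (W * (U * CFC.sqrt (CFC.abs R))), ?_, ?_⟩
    · rw [hsSq_adjoint, eTraceNorm_eq_hsSq]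
      exact (hsSq_mul_le _ _ hW).trans (hsSq_mul_le _ _ hU)
    · rw [star_star, mul_assoc, mul_assoc, CFC.sqrt_mul_sqrt_self _ (CFC.abs_nonneg R), ← hUe]
  obtain ⟨A, hA, hAe⟩ := key S
  obtain ⟨B, hB, hBe⟩ := key T
  have am : ∀ C R : H →L[ℂ] H, ∀ x : H,
      (⟪x, (star C * R) x⟫_ℂ).re ≤ (‖C x‖ ^ 2 + ‖R x‖ ^ 2) / 2 := by
    intro C R x
    rw [mul_apply_eq_comp, ContinuousLinearMap.star_eq_adjoint,
      ContinuousLinearMap.adjoint_inner_right]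
    have h1 : (⟪C x, R x⟫_ℂ).re ≤ ‖C x‖ * ‖R x‖ := re_inner_le_norm (𝕜 := ℂ) _ _
    nlinarith [sq_nonneg (‖C x‖ - ‖R x‖)]
  have h2 : 2 * eTraceNorm (S + T) ≤ 2 * (eTraceNorm S + eTraceNorm T) := by
    calc 2 * eTraceNorm (S + T)
        = ∑' i, 2 * ENNReal.ofReal (⟪basis H i, CFC.abs (S + T) (basis H i)⟫_ℂ).re := by
          rw [ENNReal.tsum_mul_left]; rfl
      _ ≤ ∑' i, (ENNReal.ofReal (‖A (basis H i)‖ ^ 2)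
            + ENNReal.ofReal (‖CFC.sqrt (CFC.abs S) (basis H i)‖ ^ 2)
            + (ENNReal.ofReal (‖B (basis H i)‖ ^ 2)
            + ENNReal.ofReal (‖CFC.sqrt (CFC.abs T) (basis H i)‖ ^ 2))) := by
          refine ENNReal.tsum_le_tsum fun i => ?_
          rw [← ENNReal.ofReal_add (by positivity) (by positivity),
            ← ENNReal.ofReal_add (by positivity) (by positivity),
            ← ENNReal.ofReal_add (by positivity) (by positivity),
            ← ENNReal.ofReal_ofNat 2, ← ENNReal.ofReal_mul (by norm_num)]
          refine ENNReal.ofReal_le_ofReal ?_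
          rw [hWe, mul_add, hAe, hBe, add_apply, inner_add_right,
            Complex.add_re]
          linarith [am A (CFC.sqrt (CFC.abs S)) (basis H i),
            am B (CFC.sqrt (CFC.abs T)) (basis H i)]
      _ = hsSq A + eTraceNorm S + (hsSq B + eTraceNorm T) := by
          rw [ENNReal.tsum_add, ENNReal.tsum_add, ENNReal.tsum_add, eTraceNorm_eq_hsSq,
            eTraceNorm_eq_hsSq]
          rfl
      _ ≤ eTraceNorm S + eTraceNorm S + (eTraceNorm T + eTraceNorm T) := by gcongr
      _ = 2 * (eTraceNorm S + eTraceNorm T) := by ring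
  exact (ENNReal.mul_le_mul_iff_right (by norm_num) (by norm_num)).1 h2

theorem eTraceNorm_zero : eTraceNorm (0 : H →L[ℂ] H) = 0 := by
  simp [eTraceNorm]

theorem eTraceNorm_smul (c : ℂ) (T : H →L[ℂ] H) :
    eTraceNorm (c • T) = ENNReal.ofReal ‖c‖ * eTraceNorm T := by
  unfold eTraceNorm
  rw [← ENNReal.tsum_mul_left]
  refine tsum_congr fun i => ?_
  rw [← ENNReal.ofReal_mul (norm_nonneg c), CFC.abs_smul, smul_apply,
    inner_smul_right_eq_smul, Complex.smul_re, smul_eq_mul]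

/-- `𝓢₁(H)`: the space of trace class operators on `H`. -/
noncomputable def TraceClass (H : Type*) [NormedAddCommGroup H] [InnerProductSpace ℂ H]
    [CompleteSpace H] : Submodule ℂ (H →L[ℂ] H) where
  carrier := {T | eTraceNorm T < ∞}
  zero_mem' := by simp [eTraceNorm_zero]
  add_mem' := fun {S T} hS hT =>
    (eTraceNorm_add_le S T).trans_lt (ENNReal.add_lt_top.2 ⟨hS, hT⟩)
  smul_mem' := fun c T hT => by
    simp only [Set.mem_ofPred_eq, eTraceNorm_smul] at *
    exact ENNReal.mul_lt_top ENNReal.ofReal_lt_top hT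

/-- The trace norm `‖X‖₁` of a trace class operator. -/
noncomputable def traceNorm (X : TraceClass H) : ℝ :=
  (eTraceNorm (X : H →L[ℂ] H)).toReal

/-- The trace `tr X` of a trace class operator. -/
noncomputable def trace (X : TraceClass H) : ℂ :=
  ∑' i, ⟪basis H i, (X : H →L[ℂ] H) (basis H i)⟫_ℂ

end TraceClass

section Channel

variable (H K : Type*) [NormedAddCommGroup H] [InnerProductSpace ℂ H] [CompleteSpace H]
  [NormedAddCommGroup K] [InnerProductSpace ℂ K] [CompleteSpace K]

variable {H} in
/-- Positivity of the operator on `H ⊗ ℂⁿ = Hⁿ` whose block matrix is `(X i j)`. -/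
def BlockPositive {n : ℕ} (X : Fin n → Fin n → TraceClass H) : Prop :=
  ∀ x : Fin n → H, 0 ≤ ∑ i, ∑ j, ⟪x i, (X i j : H →L[ℂ] H) (x j)⟫_ℂ

variable {H K} in
/-- Complete positivity: `Λ ⊗ Iₙ`, which acts on block matrices with entries in `𝓢₁(H)` by
applying `Λ` to every entry, is positive for every `n`. -/
def CompletelyPositive (Λ : TraceClass H →ₗ[ℂ] TraceClass K) : Prop :=
  ∀ (n : ℕ) (X : Fin n → Fin n → TraceClass H),
    BlockPositive X → BlockPositive fun i j => Λ (X i j)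

variable {H K} in
/-- `tr Λ(X) = tr X` for all trace class `X`. -/
def TracePreserving (Λ : TraceClass H →ₗ[ℂ] TraceClass K) : Prop :=
  ∀ X, trace (Λ X) = trace X

/-- `Ch(H, K)`: the completely positive trace preserving (CPTP) linear maps
`𝓢₁(H) → 𝓢₁(K)`. -/
structure Channel where
  toLinearMap : TraceClass H →ₗ[ℂ] TraceClass K
  completelyPositive : CompletelyPositive toLinearMap
  tracePreserving : TracePreserving toLinearMap

noncomputable instance : CoeFun (Channel H K) fun _ => TraceClass H → TraceClass K :=
  ⟨fun Λ => Λ.toLinearMap⟩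

end Channel

/-- A quantum experiment: a family of states (density operators) on `H` indexed by `Θ`. -/
structure QuantumExperiment (Θ : Type*) (H : Type*) [NormedAddCommGroup H]
    [InnerProductSpace ℂ H] [CompleteSpace H] where
  state : Θ → TraceClass H
  nonneg : ∀ θ, (state θ : H →L[ℂ] H).IsPositive
  trace_eq_one : ∀ θ, trace (state θ) = 1

/-- Loss functions with quantum decision space `HD`: `L θ X ≥ 0` for `X ≥ 0`, and `L θ` is
1-Lipschitz for the trace norm on `{X | X ≥ 0, tr X ≤ 1}`. -/
structure LossFunction (Θ : Type*) (HD : Type*) [NormedAddCommGroup HD]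
    [InnerProductSpace ℂ HD] [CompleteSpace HD] where
  loss : Θ → TraceClass HD → ℝ
  nonneg : ∀ (θ : Θ) (X : TraceClass HD), (X : HD →L[ℂ] HD).IsPositive → 0 ≤ loss θ X
  lipschitz : ∀ (θ : Θ) (X Y : TraceClass HD), (X : HD →L[ℂ] HD).IsPositive → (Y : HD →L[ℂ] HD).IsPositive →
    (trace X).re ≤ 1 → (trace Y).re ≤ 1 → |loss θ X - loss θ Y| ≤ traceNorm (X - Y)

section Deficiency

variable {Θ : Type t} {H : Type u} {K : Type v}
  [NormedAddCommGroup H] [InnerProductSpace ℂ H] [CompleteSpace H]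
  [NormedAddCommGroup K] [InnerProductSpace ℂ K] [CompleteSpace K]

/-- `E ≥^q_{e,k} F`: `E` is q-`e`-deficient relative to `F` for `k`-decision problems. The
decision space `HD` runs over the separable Hilbert spaces with `dim HD = k`, where `k = ⊤`
means infinite dimension; infimum and supremum are taken in `[-∞, ∞]`. -/
def QDeficientFor (k : ℕ∞) (e : Θ → ℝ) (E : QuantumExperiment Θ H)
    (F : QuantumExperiment Θ K) : Prop :=
  ∀ (HD : Type w) [NormedAddCommGroup HD] [InnerProductSpace ℂ HD] [CompleteSpace HD]
    [TopologicalSpace.SeparableSpace HD],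
    Cardinal.toENat (Module.rank ℂ HD) = k →
    ∀ (L : LossFunction Θ HD) (D : Channel K HD),
      (⨅ D' : Channel H HD, ⨆ θ : Θ,
        ((L.loss θ (D' (E.state θ)) - L.loss θ (D (F.state θ)) - e θ : ℝ) : EReal)) ≤ 0

/-- `E ≥^q_e F`: `E` is q-`e`-deficient relative to `F`, the case `k = ∞`. -/
def QDeficient (e : Θ → ℝ) (E : QuantumExperiment Θ H) (F : QuantumExperiment Θ K) : Prop :=
  QDeficientFor.{t, u, v, w} ⊤ e E F

end Deficiency

end QStat

/-! If a channel `Λ` meets the bound, then for any decision `D` the decision `D ∘ Λ` works for every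
loss function at once: losses are 1-Lipschitz and channels contract the trace norm of self-adjoint
operators (`qDeficient_of_channel`).

Conversely, one decision problem suffices, and no minimax argument is needed. Embed `K`
isometrically by `V` into an infinite-dimensional separable space and take as loss the trace
distance to `V σ_θ V†`. This loss vanishes at the decision `X ↦ V X V†`, so deficiency gives, for
every `ε > 0`, a channel whose outputs are within `e θ + ε` of `V σ_θ V†`
(`exists_channel_traceNorm_lt`). Compress these channels by `V†` and take a limit `Λ₀` along an
ultrafilter in the weak operator topology (`exists_tendsto_completelyPositive`). Compression and
limit keep complete positivity but may lose trace. The lost trace is put back on a fixed pure state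
(`exists_channel_ge`), which gives a channel `Λ` with `Λ₀ ρ ≤ Λ ρ` for `ρ ≥ 0`.

The repair does not spoil the bound. A self-adjoint `A` of trace zero has `‖A‖₁ = 2 tr A⁺`, and `tr
A⁺` is a supremum of finite sums `∑ ⟪E b_i, A E b_i⟫` over contractions `E`. For `A = σ_θ - Λ ρ_θ`
each sum only grows when `Λ` is replaced by `Λ₀`, and the sums for `Λ₀` are limits of sums bounded
by `(e θ + ε) / 2`. -/

namespace QStat

/-! ### Hilbert–Schmidt norm of operators between two spaces -/

section HilbertSchmidt

variable {H K G : Type*} [NormedAddCommGroup H] [InnerProductSpace ℂ H] [CompleteSpace H]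
  [NormedAddCommGroup K] [InnerProductSpace ℂ K] [CompleteSpace K]
  [NormedAddCommGroup G] [InnerProductSpace ℂ G] [CompleteSpace G]

/-- The squared Hilbert-Schmidt norm of an operator between two Hilbert spaces. -/
noncomputable def hsNormSq (A : H →L[ℂ] K) : ℝ≥0∞ :=
  ∑' i, ENNReal.ofReal (‖A (basis H i)‖ ^ 2)

/-- By Parseval both sides are the double sum of the squared matrix entries, summed in either order.
-/
theorem hsNormSq_adjoint (A : H →L[ℂ] K) :
    hsNormSq (ContinuousLinearMap.adjoint A) = hsNormSq A := by
  unfold hsNormSq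
  rw [tsum_congr fun i => parseval (ContinuousLinearMap.adjoint A (basis K i)),
    tsum_congr fun i => parseval (A (basis H i)), ENNReal.tsum_comm]
  refine tsum_congr fun i => tsum_congr fun j => ?_
  rw [ContinuousLinearMap.adjoint_inner_right, norm_inner_symm]

omit [CompleteSpace K] [CompleteSpace G] in
theorem hsNormSq_comp_le_right (B : K →L[ℂ] G) (A : H →L[ℂ] K) (hB : ‖B‖ ≤ 1) :
    hsNormSq (B ∘L A) ≤ hsNormSq A := by
  refine ENNReal.tsum_le_tsum fun i => ENNReal.ofReal_le_ofReal ?_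
  have : ‖B (A (basis H i))‖ ≤ ‖A (basis H i)‖ := by
    simpa using B.le_of_opNorm_le hB (A (basis H i))
  exact pow_le_pow_left₀ (norm_nonneg _) this 2

theorem hsNormSq_comp_le_left (B : K →L[ℂ] G) (A : H →L[ℂ] K) (hA : ‖A‖ ≤ 1) :
    hsNormSq (B ∘L A) ≤ hsNormSq B := by
  rw [← hsNormSq_adjoint, ContinuousLinearMap.adjoint_comp, ← hsNormSq_adjoint B]
  exact hsNormSq_comp_le_right _ _ (by rwa [LinearIsometryEquiv.norm_map])

/-- The coefficients of `A x` are `⟪A† b_i, x⟫`; apply Cauchy–Schwarz to each and sum. -/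
theorem norm_apply_sq_le_hsNormSq (A : H →L[ℂ] K) (x : H) :
    ENNReal.ofReal (‖A x‖ ^ 2) ≤ ENNReal.ofReal (‖x‖ ^ 2) * hsNormSq A := by
  rw [parseval, ← hsNormSq_adjoint, hsNormSq, ← ENNReal.tsum_mul_left]
  refine ENNReal.tsum_le_tsum fun i => ?_
  rw [← ENNReal.ofReal_mul (by positivity), ← mul_pow]
  refine ENNReal.ofReal_le_ofReal (pow_le_pow_left₀ (norm_nonneg _) ?_ 2)
  rw [← ContinuousLinearMap.adjoint_inner_left, mul_comm]
  exact norm_inner_le_norm _ _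

end HilbertSchmidt

/-! ### Trace norm: conjugation, adjoint, positive and negative parts -/

section TraceNorm

variable {H K : Type*} [NormedAddCommGroup H] [InnerProductSpace ℂ H] [CompleteSpace H]
  [NormedAddCommGroup K] [InnerProductSpace ℂ K] [CompleteSpace K]

theorem eTraceNorm_of_isPositive {T : H →L[ℂ] H} (hT : T.IsPositive) :
    eTraceNorm T = ∑' i, ENNReal.ofReal (⟪basis H i, T (basis H i)⟫_ℂ).re := by
  rw [eTraceNorm, CFC.abs_of_nonneg T ((ContinuousLinearMap.nonneg_iff_isPositive T).2 hT)]

theorem inner_apply_eq_norm_sqrt_sq {T : H →L[ℂ] H} (hT : T.IsPositive) (x : H) :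
    (⟪x, T x⟫_ℂ).re = ‖CFC.sqrt T x‖ ^ 2 := by
  have hT' := (ContinuousLinearMap.nonneg_iff_isPositive T).2 hT
  have hs : star (CFC.sqrt T) = CFC.sqrt T := (CFC.sqrt_nonneg T).isSelfAdjoint.star_eq
  conv_lhs => rw [← CFC.sqrt_mul_sqrt_self T hT', mul_apply_eq_comp, ← hs,
    ContinuousLinearMap.star_eq_adjoint, ContinuousLinearMap.adjoint_inner_right,
    ← ContinuousLinearMap.star_eq_adjoint, hs]
  rw [inner_self_eq_norm_sq_to_K]; norm_cast

theorem eTraceNorm_eq_hsNormSq {T : H →L[ℂ] H} (hT : T.IsPositive) :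
    eTraceNorm T = hsNormSq (CFC.sqrt T) := by
  rw [eTraceNorm_of_isPositive hT]
  exact tsum_congr fun i => by rw [inner_apply_eq_norm_sqrt_sq hT]

/-- Conjugation by a contraction does not increase the trace of a positive operator. -/
theorem tsum_inner_apply_le {T : K →L[ℂ] K} (hT : T.IsPositive) {C : H →L[ℂ] K} (hC : ‖C‖ ≤ 1) :
    ∑' i, ENNReal.ofReal (⟪C (basis H i), T (C (basis H i))⟫_ℂ).re ≤ eTraceNorm T := by
  rw [eTraceNorm_eq_hsNormSq hT]
  refine le_trans (le_of_eq ?_) (hsNormSq_comp_le_left (CFC.sqrt T) C hC)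
  exact tsum_congr fun i => by rw [inner_apply_eq_norm_sqrt_sq hT]; rfl

theorem eTraceNorm_conj_le {T : K →L[ℂ] K} (hT : T.IsPositive) {C : H →L[ℂ] K} (hC : ‖C‖ ≤ 1) :
    eTraceNorm (ContinuousLinearMap.adjoint C ∘L T ∘L C) ≤ eTraceNorm T := by
  rw [eTraceNorm_of_isPositive (hT.adjoint_conj C)]
  refine le_trans (le_of_eq (tsum_congr fun i => ?_)) (tsum_inner_apply_le hT hC)
  rw [ContinuousLinearMap.comp_apply, ContinuousLinearMap.adjoint_inner_right]
  rfl

theorem eTraceNorm_neg (T : H →L[ℂ] H) : eTraceNorm (-T) = eTraceNorm T := by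
  rw [eTraceNorm, CFC.abs_neg, eTraceNorm]

/-- With `|T†| = W T†`, `T = U |T|` and `R = √|T|`, one gets `|T†| = (W R)(R U†)`. Each factor has
Hilbert–Schmidt norm at most that of `R`, up to an adjoint, and `2ab ≤ a² + b²` bounds the diagonal
of the product. -/
theorem eTraceNorm_star_le (T : H →L[ℂ] H) : eTraceNorm (star T) ≤ eTraceNorm T := by
  obtain ⟨W, hW, hWe⟩ := exists_factor (CFC.abs (star T)) (star T) fun x => (norm_abs_apply _ x).le
  obtain ⟨U, hU, hUe⟩ := exists_factor T (CFC.abs T) fun x => (norm_abs_apply _ x).ge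
  set R := CFC.sqrt (CFC.abs T) with hR
  have hRR : R * R = CFC.abs T := CFC.sqrt_mul_sqrt_self _ (CFC.abs_nonneg T)
  have hRs : star R = R := (CFC.sqrt_nonneg (CFC.abs T)).isSelfAdjoint.star_eq
  have key : CFC.abs (star T) = star (R * star W) * (R * star U) := by
    rw [hWe, star_mul, star_star, hRs]
    conv_lhs => rw [hUe, star_mul, (CFC.abs_nonneg T).isSelfAdjoint.star_eq, ← hRR]
    simp only [mul_assoc]
  have h2 : 2 * eTraceNorm (star T) ≤ 2 * eTraceNorm T := by
    calc 2 * eTraceNorm (star T)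
        ≤ ∑' i, (ENNReal.ofReal (‖(R * star W) (basis H i)‖ ^ 2)
            + ENNReal.ofReal (‖(R * star U) (basis H i)‖ ^ 2)) := by
          rw [eTraceNorm, ← ENNReal.tsum_mul_left]
          refine ENNReal.tsum_le_tsum fun i => ?_
          rw [← ENNReal.ofReal_add (by positivity) (by positivity),
            ← ENNReal.ofReal_ofNat 2, ← ENNReal.ofReal_mul (by norm_num)]
          refine ENNReal.ofReal_le_ofReal ?_
          rw [key, mul_apply_eq_comp (star (R * star W)), ContinuousLinearMap.star_eq_adjoint,
            ContinuousLinearMap.adjoint_inner_right]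
          have h1 := re_inner_le_norm (𝕜 := ℂ) ((R * star W) (basis H i))
            ((R * star U) (basis H i))
          rw [RCLike.re_eq_complex_re] at h1
          nlinarith [sq_nonneg (‖(R * star W) (basis H i)‖ - ‖(R * star U) (basis H i)‖)]
      _ = hsNormSq (R * star W) + hsNormSq (R * star U) := ENNReal.tsum_add
      _ ≤ hsNormSq R + hsNormSq R :=
          add_le_add (hsNormSq_comp_le_left R (star W) (by rwa [norm_star]))
            (hsNormSq_comp_le_left R (star U) (by rwa [norm_star]))
      _ = 2 * eTraceNorm T := by rw [eTraceNorm_eq_hsSq, two_mul]; rfl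
  exact (ENNReal.mul_le_mul_iff_right (by norm_num) (by norm_num)).1 h2

theorem isPositive_posPart (T : H →L[ℂ] H) : (T⁺).IsPositive :=
  (ContinuousLinearMap.nonneg_iff_isPositive _).1 (CFC.posPart_nonneg T)

theorem isPositive_negPart (T : H →L[ℂ] H) : (T⁻).IsPositive :=
  (ContinuousLinearMap.nonneg_iff_isPositive _).1 (CFC.negPart_nonneg T)

omit [CompleteSpace H] in
theorem re_inner_apply_nonneg {T : H →L[ℂ] H} (hT : T.IsPositive) (x : H) :
    0 ≤ (⟪x, T x⟫_ℂ).re :=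
  (Complex.nonneg_iff.1 (hT.inner_nonneg_right x)).1

theorem ofReal_toReal_inner_apply {T : H →L[ℂ] H} (hT : T.IsPositive) (x : H) :
    ((ENNReal.ofReal (⟪x, T x⟫_ℂ).re).toReal : ℂ) = ⟪x, T x⟫_ℂ := by
  rw [ENNReal.toReal_ofReal (re_inner_apply_nonneg hT x)]
  exact Complex.ext rfl (Complex.nonneg_iff.1 (hT.inner_nonneg_right x)).2

theorem eTraceNorm_add_of_isPositive {S T : H →L[ℂ] H} (hS : S.IsPositive) (hT : T.IsPositive) :
    eTraceNorm (S + T) = eTraceNorm S + eTraceNorm T := by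
  rw [eTraceNorm_of_isPositive hS, eTraceNorm_of_isPositive hT,
    eTraceNorm_of_isPositive (hS.add hT), ← ENNReal.tsum_add]
  refine tsum_congr fun i => ?_
  rw [← ENNReal.ofReal_add (re_inner_apply_nonneg hS _) (re_inner_apply_nonneg hT _),
    add_apply, inner_add_right, Complex.add_re]

theorem eTraceNorm_eq_posPart_add_negPart {T : H →L[ℂ] H} (hT : IsSelfAdjoint T) :
    eTraceNorm T = eTraceNorm T⁺ + eTraceNorm T⁻ := by
  rw [← eTraceNorm_add_of_isPositive (isPositive_posPart T) (isPositive_negPart T),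
    CFC.posPart_add_negPart T hT, eTraceNorm, eTraceNorm, CFC.abs_of_nonneg _ (CFC.abs_nonneg T)]

end TraceNorm

/-! ### Trace class operators and the trace functional -/

section TraceClass

variable {H K : Type*} [NormedAddCommGroup H] [InnerProductSpace ℂ H] [CompleteSpace H]
  [NormedAddCommGroup K] [InnerProductSpace ℂ K] [CompleteSpace K]

theorem mem_traceClass_iff {T : H →L[ℂ] H} : T ∈ TraceClass H ↔ eTraceNorm T < ∞ := Iff.rfl

theorem posPart_mem_traceClass {T : H →L[ℂ] H} (hT : IsSelfAdjoint T) (h : T ∈ TraceClass H) :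
    T⁺ ∈ TraceClass H := by
  rw [mem_traceClass_iff, eTraceNorm_eq_posPart_add_negPart hT] at h
  exact (le_self_add).trans_lt h

theorem negPart_mem_traceClass {T : H →L[ℂ] H} (hT : IsSelfAdjoint T) (h : T ∈ TraceClass H) :
    T⁻ ∈ TraceClass H := by
  rw [mem_traceClass_iff, eTraceNorm_eq_posPart_add_negPart hT] at h
  exact (le_add_self).trans_lt h

theorem star_mem_traceClass {T : H →L[ℂ] H} (h : T ∈ TraceClass H) : star T ∈ TraceClass H :=
  (eTraceNorm_star_le T).trans_lt h

/-- Every trace class operator is a linear combination of positive ones. -/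
theorem TraceClass.induction_on {p : TraceClass H → Prop} (X : TraceClass H)
    (pos : ∀ X : TraceClass H, (X : H →L[ℂ] H).IsPositive → p X)
    (add : ∀ X Y, p X → p Y → p (X + Y)) (smul : ∀ (c : ℂ) X, p X → p (c • X)) : p X := by
  have sub : ∀ X Y, p X → p Y → p (X - Y) := fun X Y hX hY => by
    rw [sub_eq_add_neg, ← neg_one_smul ℂ Y]; exact add _ _ hX (smul _ _ hY)
  have sa : ∀ (Y : TraceClass H), IsSelfAdjoint (Y : H →L[ℂ] H) → p Y := fun Y hY => by
    have e : Y = ⟨_, posPart_mem_traceClass hY Y.2⟩ - ⟨_, negPart_mem_traceClass hY Y.2⟩ :=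
      Subtype.ext (CFC.posPart_sub_negPart _ hY).symm
    rw [e]
    exact sub _ _ (pos _ (isPositive_posPart _)) (pos _ (isPositive_negPart _))
  have hs := star_mem_traceClass X.2
  have hre : (realPart (X : H →L[ℂ] H) : H →L[ℂ] H) ∈ TraceClass H := by
    rw [realPart_apply_coe]
    have := (TraceClass H).smul_mem ((2⁻¹ : ℝ) : ℂ) ((TraceClass H).add_mem X.2 hs)
    rwa [Complex.coe_smul] at this
  have him : (imaginaryPart (X : H →L[ℂ] H) : H →L[ℂ] H) ∈ TraceClass H := by
    rw [imaginaryPart_apply_coe]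
    have := (TraceClass H).smul_mem (-Complex.I) ((TraceClass H).smul_mem ((2⁻¹ : ℝ) : ℂ)
      ((TraceClass H).sub_mem X.2 hs))
    rwa [Complex.coe_smul] at this
  have e : X = ⟨_, hre⟩ + Complex.I • ⟨_, him⟩ :=
    Subtype.ext (realPart_add_I_smul_imaginaryPart _).symm
  rw [e]
  exact add _ _ (sa _ (realPart _).2) (smul _ _ (sa _ (imaginaryPart _).2))

theorem summable_inner_basis (X : TraceClass H) :
    Summable fun i => ⟪basis H i, (X : H →L[ℂ] H) (basis H i)⟫_ℂ := by
  refine TraceClass.induction_on (p := fun X : TraceClass H =>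
    Summable fun i => ⟪basis H i, (X : H →L[ℂ] H) (basis H i)⟫_ℂ) X (fun X hX => ?_)
    (fun X Y hX hY => ?_) fun c X hX => ?_
  · have h : (∑' i, ENNReal.ofReal (⟪basis H i, (X : H →L[ℂ] H) (basis H i)⟫_ℂ).re) ≠ ∞ :=
      (eTraceNorm_of_isPositive hX) ▸ (mem_traceClass_iff.1 X.2).ne
    have h2 := ENNReal.summable_toReal h
    have h3 := Complex.ofRealCLM.summable h2
    exact h3.congr fun i => ofReal_toReal_inner_apply hX _
  · simpa [inner_add_right] using hX.add hY
  · simpa [inner_smul_right] using hX.mul_left c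

/-- The trace as a linear functional. -/
noncomputable def traceₗ (H : Type*) [NormedAddCommGroup H] [InnerProductSpace ℂ H]
    [CompleteSpace H] : TraceClass H →ₗ[ℂ] ℂ where
  toFun := trace
  map_add' X Y := by
    rw [trace, trace, trace, ← (summable_inner_basis X).tsum_add (summable_inner_basis Y)]
    exact tsum_congr fun i => by simp
  map_smul' c X := by
    rw [trace, trace, RingHom.id_apply, smul_eq_mul, ← tsum_mul_left]
    exact tsum_congr fun i => by simp

theorem traceₗ_apply (X : TraceClass H) : traceₗ H X = trace X := rfl

theorem trace_add (X Y : TraceClass H) : trace (X + Y) = trace X + trace Y :=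
  (traceₗ H).map_add X Y

theorem trace_sub (X Y : TraceClass H) : trace (X - Y) = trace X - trace Y :=
  (traceₗ H).map_sub X Y

theorem ofReal_traceNorm (X : TraceClass H) :
    ENNReal.ofReal (traceNorm X) = eTraceNorm (X : H →L[ℂ] H) :=
  ENNReal.ofReal_toReal (mem_traceClass_iff.1 X.2).ne

theorem traceNorm_nonneg (X : TraceClass H) : 0 ≤ traceNorm X := ENNReal.toReal_nonneg

theorem traceNorm_zero : traceNorm (0 : TraceClass H) = 0 := by
  simp [traceNorm, eTraceNorm_zero]

theorem traceNorm_neg (X : TraceClass H) : traceNorm (-X) = traceNorm X := by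
  simp [traceNorm, eTraceNorm_neg]

theorem traceNorm_add_le (X Y : TraceClass H) :
    traceNorm (X + Y) ≤ traceNorm X + traceNorm Y := by
  rw [traceNorm, traceNorm, traceNorm, ← ENNReal.toReal_add (mem_traceClass_iff.1 X.2).ne
    (mem_traceClass_iff.1 Y.2).ne]
  exact ENNReal.toReal_mono (ENNReal.add_lt_top.2 ⟨X.2, Y.2⟩).ne (eTraceNorm_add_le _ _)

theorem abs_traceNorm_sub_le (X Y : TraceClass H) :
    |traceNorm X - traceNorm Y| ≤ traceNorm (X - Y) := by
  have h1 := traceNorm_add_le (X - Y) Y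
  have h2 := traceNorm_add_le (Y - X) X
  rw [sub_add_cancel] at h1 h2
  rw [← neg_sub X Y, traceNorm_neg] at h2
  exact abs_sub_le_iff.2 ⟨by linarith, by linarith⟩

theorem trace_of_isPositive {X : TraceClass H} (hX : (X : H →L[ℂ] H).IsPositive) :
    trace X = (traceNorm X : ℂ) := by
  rw [traceNorm, eTraceNorm_of_isPositive hX, ENNReal.tsum_toReal_eq fun _ => ENNReal.ofReal_ne_top,
    Complex.ofReal_tsum, trace]
  exact tsum_congr fun i => (ofReal_toReal_inner_apply hX _).symm

/-- The operator norm of `√X` is at most its Hilbert–Schmidt norm, whose square is the trace of `X`.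
-/
theorem norm_apply_le_traceNorm {X : TraceClass H} (hX : (X : H →L[ℂ] H).IsPositive) :
    ‖(X : H →L[ℂ] H)‖ ≤ traceNorm X := by
  have hX' := (ContinuousLinearMap.nonneg_iff_isPositive _).2 hX
  set R := CFC.sqrt (X : H →L[ℂ] H)
  have h : ‖R‖ ≤ Real.sqrt (traceNorm X) := by
    refine R.opNorm_le_bound (Real.sqrt_nonneg _) fun x => ?_
    have h1 := norm_apply_sq_le_hsNormSq R x
    rw [← eTraceNorm_eq_hsNormSq hX, ← ofReal_traceNorm, ← ENNReal.ofReal_mul (sq_nonneg _),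
      ENNReal.ofReal_le_ofReal_iff (mul_nonneg (sq_nonneg _) (traceNorm_nonneg X))] at h1
    refine abs_le_of_sq_le_sq' ?_ (by positivity) |>.2
    rwa [mul_pow, Real.sq_sqrt (traceNorm_nonneg X), mul_comm]
  calc ‖(X : H →L[ℂ] H)‖ = ‖R * R‖ := by rw [CFC.sqrt_mul_sqrt_self _ hX']
    _ ≤ ‖R‖ * ‖R‖ := norm_mul_le _ _
    _ ≤ Real.sqrt (traceNorm X) * Real.sqrt (traceNorm X) := by gcongr
    _ = traceNorm X := Real.mul_self_sqrt (traceNorm_nonneg X)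

/-- The positive part of a self-adjoint trace class operator. -/
noncomputable def posTC (X : TraceClass H) (hX : IsSelfAdjoint (X : H →L[ℂ] H)) : TraceClass H :=
  ⟨_, posPart_mem_traceClass hX X.2⟩

/-- The negative part of a self-adjoint trace class operator. -/
noncomputable def negTC (X : TraceClass H) (hX : IsSelfAdjoint (X : H →L[ℂ] H)) : TraceClass H :=
  ⟨_, negPart_mem_traceClass hX X.2⟩

theorem posTC_sub_negTC (X : TraceClass H) (hX : IsSelfAdjoint (X : H →L[ℂ] H)) :
    posTC X hX - negTC X hX = X :=
  Subtype.ext (CFC.posPart_sub_negPart _ hX)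

theorem traceNorm_posTC_add_negTC (X : TraceClass H) (hX : IsSelfAdjoint (X : H →L[ℂ] H)) :
    traceNorm (posTC X hX) + traceNorm (negTC X hX) = traceNorm X := by
  rw [traceNorm, traceNorm, traceNorm, eTraceNorm_eq_posPart_add_negPart hX,
    ENNReal.toReal_add (mem_traceClass_iff.1 (posPart_mem_traceClass hX X.2)).ne
      (mem_traceClass_iff.1 (negPart_mem_traceClass hX X.2)).ne]
  rfl

/-- Trace zero means that the positive and negative parts have equal trace. -/
theorem traceNorm_eq_two_mul_posTC (X : TraceClass H) (hX : IsSelfAdjoint (X : H →L[ℂ] H))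
    (h0 : trace X = 0) : traceNorm X = 2 * traceNorm (posTC X hX) := by
  have h1 : trace X = trace (posTC X hX) - trace (negTC X hX) := by
    rw [← trace_sub, posTC_sub_negTC]
  rw [h0, trace_of_isPositive (isPositive_posPart _), trace_of_isPositive (isPositive_negPart _),
    ← Complex.ofReal_sub, eq_comm, Complex.ofReal_eq_zero] at h1
  linarith [traceNorm_posTC_add_negTC X hX]

end TraceClass

/-! ### Channels, conjugation by contractions and isometries -/

section Channel

variable {H K G : Type*} [NormedAddCommGroup H] [InnerProductSpace ℂ H] [CompleteSpace H]
  [NormedAddCommGroup K] [InnerProductSpace ℂ K] [CompleteSpace K]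
  [NormedAddCommGroup G] [InnerProductSpace ℂ G] [CompleteSpace G]

omit [CompleteSpace H] in
theorem isPositive_of_inner_nonneg {T : H →L[ℂ] H} (h : ∀ x, 0 ≤ ⟪x, T x⟫_ℂ) : T.IsPositive := by
  refine (ContinuousLinearMap.isPositive_iff_complex T).2 fun x => ?_
  have h1 : 0 ≤ ⟪T x, x⟫_ℂ := by
    rw [← inner_conj_symm]
    exact star_nonneg_iff.2 (h x)
  exact ⟨Complex.ext rfl (Complex.nonneg_iff.1 h1).2, (Complex.nonneg_iff.1 h1).1⟩

theorem CompletelyPositive.isPositive {Λ : TraceClass H →ₗ[ℂ] TraceClass K}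
    (h : CompletelyPositive Λ) {X : TraceClass H} (hX : (X : H →L[ℂ] H).IsPositive) :
    (Λ X : K →L[ℂ] K).IsPositive := by
  refine isPositive_of_inner_nonneg fun x => ?_
  simpa using h 1 (fun _ _ => X) (fun y => by simpa using hX.inner_nonneg_right (y 0)) fun _ => x

theorem CompletelyPositive.comp {Λ : TraceClass H →ₗ[ℂ] TraceClass K}
    {Φ : TraceClass K →ₗ[ℂ] TraceClass G} (hΦ : CompletelyPositive Φ) (hΛ : CompletelyPositive Λ) :
    CompletelyPositive (Φ ∘ₗ Λ) :=
  fun n X hX => hΦ n _ (hΛ n X hX)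

/-- Composition of channels. -/
noncomputable def Channel.comp (Φ : Channel K G) (Λ : Channel H K) : Channel H G where
  toLinearMap := Φ.toLinearMap ∘ₗ Λ.toLinearMap
  completelyPositive := Φ.completelyPositive.comp Λ.completelyPositive
  tracePreserving X := (Φ.tracePreserving _).trans (Λ.tracePreserving X)

theorem Channel.traceNorm_apply_of_isPositive (Λ : Channel H K) {X : TraceClass H}
    (hX : (X : H →L[ℂ] H).IsPositive) : traceNorm (Λ X) = traceNorm X := by
  have h := Λ.tracePreserving X
  rw [trace_of_isPositive hX, trace_of_isPositive (Λ.completelyPositive.isPositive hX)] at h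
  exact_mod_cast h

/-- Channels contract the trace norm of self-adjoint operators. -/
theorem Channel.traceNorm_apply_le (Λ : Channel H K) (X : TraceClass H)
    (hX : IsSelfAdjoint (X : H →L[ℂ] H)) : traceNorm (Λ X) ≤ traceNorm X := by
  have e : Λ X = Λ (posTC X hX) + -Λ (negTC X hX) := by
    rw [← sub_eq_add_neg, ← map_sub, posTC_sub_negTC]
  rw [e]
  refine (traceNorm_add_le _ _).trans (le_of_eq ?_)
  rw [traceNorm_neg, Λ.traceNorm_apply_of_isPositive (isPositive_posPart _),
    Λ.traceNorm_apply_of_isPositive (isPositive_negPart _), traceNorm_posTC_add_negTC]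

theorem conj_mem_traceClass {C : H →L[ℂ] K} (hC : ‖C‖ ≤ 1) (X : TraceClass H) :
    C ∘L (X : H →L[ℂ] H) ∘L ContinuousLinearMap.adjoint C ∈ TraceClass K := by
  refine TraceClass.induction_on
    (p := fun X : TraceClass H => C ∘L (X : H →L[ℂ] H) ∘L ContinuousLinearMap.adjoint C ∈ TraceClass K) X
    (fun X hX => ?_) (fun X Y hX hY => ?_) fun c X hX => ?_
  · have := eTraceNorm_conj_le hX (C := ContinuousLinearMap.adjoint C)
      (by rwa [LinearIsometryEquiv.norm_map])
    rw [ContinuousLinearMap.adjoint_adjoint] at this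
    exact this.trans_lt X.2
  · rw [Submodule.coe_add, ContinuousLinearMap.add_comp, ContinuousLinearMap.comp_add]
    exact (TraceClass K).add_mem hX hY
  · rw [Submodule.coe_smul, ContinuousLinearMap.smul_comp, ContinuousLinearMap.comp_smul]
    exact (TraceClass K).smul_mem c hX

/-- The map `X ↦ C X C†` for a contraction `C`. -/
noncomputable def conjₗ (C : H →L[ℂ] K) (hC : ‖C‖ ≤ 1) : TraceClass H →ₗ[ℂ] TraceClass K where
  toFun X := ⟨_, conj_mem_traceClass hC X⟩
  map_add' X Y := Subtype.ext <| ContinuousLinearMap.ext fun x => by simp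
  map_smul' c X := Subtype.ext <| ContinuousLinearMap.ext fun x => by simp

theorem inner_conjₗ_apply {C : H →L[ℂ] K} (hC : ‖C‖ ≤ 1) (X : TraceClass H) (x y : K) :
    ⟪x, (conjₗ C hC X : K →L[ℂ] K) y⟫_ℂ = ⟪ContinuousLinearMap.adjoint C x,
      (X : H →L[ℂ] H) (ContinuousLinearMap.adjoint C y)⟫_ℂ := by
  rw [ContinuousLinearMap.adjoint_inner_left]; rfl

theorem completelyPositive_conjₗ {C : H →L[ℂ] K} (hC : ‖C‖ ≤ 1) :
    CompletelyPositive (conjₗ C hC) := fun n X hX x => by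
  simp only [inner_conjₗ_apply]
  exact hX fun i => ContinuousLinearMap.adjoint C (x i)

theorem traceNorm_conjₗ_le {C : H →L[ℂ] K} (hC : ‖C‖ ≤ 1) {X : TraceClass H}
    (hX : (X : H →L[ℂ] H).IsPositive) : traceNorm (conjₗ C hC X) ≤ traceNorm X := by
  have := eTraceNorm_conj_le hX (C := ContinuousLinearMap.adjoint C)
      (by rwa [LinearIsometryEquiv.norm_map])
  rw [ContinuousLinearMap.adjoint_adjoint] at this
  exact ENNReal.toReal_mono (mem_traceClass_iff.1 X.2).ne this

/-- The channel `X ↦ V X V†` of an isometry `V`. -/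
noncomputable def isometryChannel (V : H →ₗᵢ[ℂ] K) : Channel H K where
  toLinearMap := conjₗ V.toContinuousLinearMap V.norm_toContinuousLinearMap_le
  completelyPositive := completelyPositive_conjₗ _
  tracePreserving X := by
    refine TraceClass.induction_on (p := fun X : TraceClass H => trace (conjₗ V.toContinuousLinearMap
      V.norm_toContinuousLinearMap_le X) = trace X) X (fun X hX => ?_) (fun X Y hX hY => ?_)
      fun c X hX => ?_
    · have hV := V.norm_toContinuousLinearMap_le
      have hV' : ‖ContinuousLinearMap.adjoint V.toContinuousLinearMap‖ ≤ 1 := by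
        rwa [LinearIsometryEquiv.norm_map]
      have hp := (completelyPositive_conjₗ hV).isPositive hX
      -- Conjugations by `V` and by `V†` both do not increase the trace of positive operators; since
      -- `V† V = 1` undoes the first, the trace is unchanged.
      have e : conjₗ _ hV' (conjₗ _ hV X) = X := by
        have hVV : ∀ x, ContinuousLinearMap.adjoint V.toContinuousLinearMap (V x) = x := fun x =>
          ext_inner_left ℂ fun y => by
            rw [ContinuousLinearMap.adjoint_inner_right]; exact V.inner_map_map y x
        refine Subtype.ext (ContinuousLinearMap.ext fun x => ext_inner_left ℂ fun y => ?_)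
        rw [inner_conjₗ_apply, inner_conjₗ_apply, ContinuousLinearMap.adjoint_adjoint]
        exact congrArg₂ (fun a b => ⟪a, (X : H →L[ℂ] H) b⟫_ℂ) (hVV y) (hVV x)
      rw [trace_of_isPositive hX, trace_of_isPositive hp]
      refine congrArg _ (le_antisymm (traceNorm_conjₗ_le hV hX) ?_)
      conv_lhs => rw [← e]
      exact traceNorm_conjₗ_le hV' hp
    · rw [map_add, trace_add, trace_add, hX, hY]
    · rw [map_smul, ← traceₗ_apply, ← traceₗ_apply, map_smul, map_smul, traceₗ_apply, hX,
        traceₗ_apply]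

theorem inner_isometryChannel_apply (V : H →ₗᵢ[ℂ] K) (X : TraceClass H) (x y : H) :
    ⟪V x, (isometryChannel V X : K →L[ℂ] K) (V y)⟫_ℂ = ⟪x, (X : H →L[ℂ] H) y⟫_ℂ := by
  have hVV : ∀ x, ContinuousLinearMap.adjoint V.toContinuousLinearMap (V x) = x := fun x =>
    ext_inner_left ℂ fun y => by
      rw [ContinuousLinearMap.adjoint_inner_right]; exact V.inner_map_map y x
  rw [isometryChannel, inner_conjₗ_apply, hVV, hVV]

end Channel

/-! ### Weak operator limits of completely positive maps -/

section Limit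

open Filter Topology

variable {H K : Type*} [NormedAddCommGroup H] [InnerProductSpace ℂ H] [CompleteSpace H]
  [NormedAddCommGroup K] [InnerProductSpace ℂ K] [CompleteSpace K]

/-- Bounded sets of operators are relatively compact for the weak operator topology. -/
theorem exists_tendsto_inner_apply {ι : Type*} (U : Ultrafilter ι) (T : ι → H →L[ℂ] H) (C : ℝ)
    (hT : ∀ k, ‖T k‖ ≤ C) :
    ∃ S : H →L[ℂ] H, ∀ x y, Tendsto (fun k => ⟪x, T k y⟫_ℂ) U (𝓝 ⟪x, S y⟫_ℂ) := by
  have hb : ∀ x y k, ‖⟪T k x, y⟫_ℂ‖ ≤ C * ‖x‖ * ‖y‖ := fun x y k =>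
    (norm_inner_le_norm _ _).trans
      (mul_le_mul_of_nonneg_right ((T k).le_of_opNorm_le (hT k) x) (norm_nonneg y))
  -- Each matrix coefficient stays in a compact disc, hence converges along the ultrafilter. The
  -- limits form a bounded sesquilinear form, represented by an operator.
  have hlim : ∀ x y, ∃ z, ‖z‖ ≤ C * ‖x‖ * ‖y‖ ∧ Tendsto (fun k => ⟪T k x, y⟫_ℂ) U (𝓝 z) := by
    intro x y
    obtain ⟨z, hz, hz'⟩ := (isCompact_closedBall (0 : ℂ) (C * ‖x‖ * ‖y‖)).ultrafilter_le_nhds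
      (U.map fun k => ⟪T k x, y⟫_ℂ)
      (by rw [le_principal_iff]; exact Filter.mem_map.2 (univ_mem' fun k => by simpa using hb x y k))
    exact ⟨z, by simpa using hz, hz'⟩
  choose B hB hBt using hlim
  let f : H →ₗ⋆[ℂ] H →ₗ[ℂ] ℂ := LinearMap.mk₂'ₛₗ (starRingEnd ℂ) (RingHom.id ℂ) B
    (fun x x' y => tendsto_nhds_unique (hBt _ _)
      (((hBt x y).add (hBt x' y)).congr fun k => by rw [map_add, inner_add_left]))
    (fun c x y => tendsto_nhds_unique (hBt _ _)
      (((hBt x y).const_mul _).congr fun k => by rw [map_smul, inner_smul_left]))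
    (fun x y y' => tendsto_nhds_unique (hBt _ _)
      (((hBt x y).add (hBt x y')).congr fun k => by rw [inner_add_right]))
    (fun c x y => tendsto_nhds_unique (hBt _ _)
      (((hBt x y).const_mul _).congr fun k => by rw [inner_smul_right]; rfl))
  refine ⟨InnerProductSpace.continuousLinearMapOfBilin (f.mkContinuous₂ C hB), fun x y => ?_⟩
  have h := (Complex.continuous_conj.tendsto _).comp (hBt y x)
  have e : ⟪x, InnerProductSpace.continuousLinearMapOfBilin (f.mkContinuous₂ C hB) y⟫_ℂ
      = starRingEnd ℂ (B y x) := by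
    rw [← inner_conj_symm, InnerProductSpace.continuousLinearMapOfBilin_apply]; rfl
  rw [e]
  exact h.congr fun k => inner_conj_symm _ _

/-- Completely positive trace non-increasing maps are pointwise bounded in operator norm, uniformly
over the maps. -/
theorem exists_norm_apply_le {ι : Type*} (Ψ : ι → TraceClass H →ₗ[ℂ] TraceClass K)
    (hΨ : ∀ k, CompletelyPositive (Ψ k))
    (hn : ∀ k (X : TraceClass H), (X : H →L[ℂ] H).IsPositive → traceNorm (Ψ k X) ≤ traceNorm X)
    (X : TraceClass H) : ∃ C, ∀ k, ‖(Ψ k X : K →L[ℂ] K)‖ ≤ C := by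
  refine TraceClass.induction_on (p := fun X : TraceClass H => ∃ C, ∀ k, ‖(Ψ k X : K →L[ℂ] K)‖ ≤ C) X
    (fun X hX => ?_) (fun X Y hX hY => ?_) fun c X hX => ?_
  · exact ⟨_, fun k => (norm_apply_le_traceNorm ((hΨ k).isPositive hX)).trans (hn k X hX)⟩
  · obtain ⟨a, ha⟩ := hX
    obtain ⟨b, hb⟩ := hY
    refine ⟨a + b, fun k => ?_⟩
    rw [map_add]
    exact (norm_add_le _ _).trans (add_le_add (ha k) (hb k))
  · obtain ⟨a, ha⟩ := hX
    refine ⟨‖c‖ * a, fun k => ?_⟩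
    rw [map_smul]
    exact (norm_smul_le _ _).trans (mul_le_mul_of_nonneg_left (ha k) (norm_nonneg c))

/-- Lower semicontinuity: finite partial sums of the diagonal converge, but mass can escape to
infinity, so the trace may drop in the limit. -/
theorem eTraceNorm_le_of_tendsto {ι : Type*} {U : Filter ι} [U.NeBot] {T : ι → H →L[ℂ] H}
    {S : H →L[ℂ] H} (hT : ∀ k, (T k).IsPositive) (hS : S.IsPositive)
    (h : ∀ x, Tendsto (fun k => ⟪x, T k x⟫_ℂ) U (𝓝 ⟪x, S x⟫_ℂ)) {c : ℝ≥0∞}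
    (hc : ∀ k, eTraceNorm (T k) ≤ c) : eTraceNorm S ≤ c := by
  rw [eTraceNorm_of_isPositive hS]
  refine ENNReal.summable.tsum_le_of_sum_le fun F => ?_
  refine le_of_tendsto (tendsto_finsetSum F fun i _ => ENNReal.tendsto_ofReal
    ((Complex.continuous_re.tendsto _).comp (h (basis H i)))) (Eventually.of_forall fun k => ?_)
  refine le_trans ?_ (hc k)
  rw [eTraceNorm_of_isPositive (hT k)]
  exact ENNReal.sum_le_tsum F

/-- Completely positive trace non-increasing maps have cluster points for pointwise convergence in
the weak operator topology. -/
theorem exists_tendsto_completelyPositive {ι : Type*} (U : Ultrafilter ι)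
    (Ψ : ι → TraceClass H →ₗ[ℂ] TraceClass K) (hΨ : ∀ k, CompletelyPositive (Ψ k))
    (hn : ∀ k (X : TraceClass H), (X : H →L[ℂ] H).IsPositive → traceNorm (Ψ k X) ≤ traceNorm X) :
    ∃ Λ : TraceClass H →ₗ[ℂ] TraceClass K, CompletelyPositive Λ ∧
      (∀ X : TraceClass H, (X : H →L[ℂ] H).IsPositive → traceNorm (Λ X) ≤ traceNorm X) ∧
      ∀ X x y, Tendsto (fun k => ⟪x, (Ψ k X : K →L[ℂ] K) y⟫_ℂ) U
        (𝓝 ⟪x, (Λ X : K →L[ℂ] K) y⟫_ℂ) := by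
  have h1 : ∀ X : TraceClass H, ∃ S : K →L[ℂ] K, ∀ x y,
      Tendsto (fun k => ⟪x, (Ψ k X : K →L[ℂ] K) y⟫_ℂ) U (𝓝 ⟪x, S y⟫_ℂ) := fun X => by
    obtain ⟨C, hC⟩ := exists_norm_apply_le Ψ hΨ hn X
    exact exists_tendsto_inner_apply U _ C hC
  choose S hS using h1
  have hadd : ∀ X Y, S (X + Y) = S X + S Y := fun X Y =>
    ContinuousLinearMap.ext fun y => ext_inner_left ℂ fun x => by
      rw [add_apply, inner_add_right]
      refine tendsto_nhds_unique (hS _ x y) (((hS X x y).add (hS Y x y)).congr fun k => ?_)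
      rw [map_add, Submodule.coe_add, add_apply, inner_add_right]
  have hsmul : ∀ (c : ℂ) X, S (c • X) = c • S X := fun c X =>
    ContinuousLinearMap.ext fun y => ext_inner_left ℂ fun x => by
      rw [smul_apply, inner_smul_right]
      refine tendsto_nhds_unique (hS _ x y) (((hS X x y).const_mul c).congr fun k => ?_)
      rw [map_smul, Submodule.coe_smul, smul_apply, inner_smul_right]
  have hpos : ∀ X : TraceClass H, (X : H →L[ℂ] H).IsPositive → (S X).IsPositive := fun X hX =>
    isPositive_of_inner_nonneg fun x => ge_of_tendsto (hS X x x)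
      (Eventually.of_forall fun k => ((hΨ k).isPositive hX).inner_nonneg_right x)
  have hle : ∀ X : TraceClass H, (X : H →L[ℂ] H).IsPositive →
      eTraceNorm (S X) ≤ eTraceNorm (X : H →L[ℂ] H) := fun X hX =>
    eTraceNorm_le_of_tendsto (fun k => (hΨ k).isPositive hX) (hpos X hX) (fun x => hS X x x)
      fun k => by
        rw [← ofReal_traceNorm, ← ofReal_traceNorm]
        exact ENNReal.ofReal_le_ofReal (hn k X hX)
  have hmem : ∀ X, S X ∈ TraceClass K := fun X =>
    TraceClass.induction_on (p := fun X : TraceClass H => S X ∈ TraceClass K) X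
      (fun X hX => (hle X hX).trans_lt X.2)
      (fun X Y hX hY => by rw [hadd]; exact (TraceClass K).add_mem hX hY)
      fun c X hX => by rw [hsmul]; exact (TraceClass K).smul_mem c hX
  refine ⟨{ toFun := fun X => ⟨S X, hmem X⟩
            map_add' := fun X Y => Subtype.ext (hadd X Y)
            map_smul' := fun c X => Subtype.ext (hsmul c X) }, fun n X hX x => ?_,
    fun X hX => ENNReal.toReal_mono (mem_traceClass_iff.1 X.2).ne (hle X hX), hS⟩
  exact ge_of_tendsto
    (tendsto_finsetSum _ fun i _ => tendsto_finsetSum _ fun j _ => hS (X i j) (x i) (x j))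
    (Eventually.of_forall fun k => hΨ k n X hX x)

end Limit

/-! ### Restoring the lost trace -/

section Completion

variable {H K : Type*} [NormedAddCommGroup H] [InnerProductSpace ℂ H] [CompleteSpace H]
  [NormedAddCommGroup K] [InnerProductSpace ℂ K] [CompleteSpace K]

omit [CompleteSpace K] in
theorem inner_rankOne_apply (u x y : K) :
    ⟪x, InnerProductSpace.rankOne ℂ u u y⟫_ℂ = ⟪x, u⟫_ℂ * ⟪u, y⟫_ℂ := by
  rw [InnerProductSpace.rankOne_apply, inner_smul_right, mul_comm]

theorem isPositive_rankOne (u : K) : (InnerProductSpace.rankOne ℂ u u).IsPositive :=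
  isPositive_of_inner_nonneg fun x => by
    rw [inner_rankOne_apply, ← inner_conj_symm x u, mul_comm]
    exact mul_star_self_nonneg _

theorem eTraceNorm_rankOne (u : K) :
    eTraceNorm (InnerProductSpace.rankOne ℂ u u) = ENNReal.ofReal (‖u‖ ^ 2) := by
  rw [eTraceNorm_of_isPositive (isPositive_rankOne u), parseval]
  refine tsum_congr fun i => ?_
  rw [inner_rankOne_apply, ← inner_conj_symm u, Complex.mul_conj, Complex.normSq_eq_norm_sq,
    Complex.ofReal_re]

/-- The projection onto the line spanned by a unit vector, as a trace class operator. -/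
noncomputable def pureState (u : K) : TraceClass K :=
  ⟨InnerProductSpace.rankOne ℂ u u, by
    rw [mem_traceClass_iff, eTraceNorm_rankOne]; exact ENNReal.ofReal_lt_top⟩

theorem trace_pureState {u : K} (hu : ‖u‖ = 1) : trace (pureState u) = 1 := by
  rw [trace_of_isPositive (isPositive_rankOne u), traceNorm]
  simp [pureState, eTraceNorm_rankOne, hu]

/-- Positive functionals are completely positive. -/
theorem completelyPositive_smulRight_pureState {f : TraceClass H →ₗ[ℂ] ℂ}
    (hf : ∀ X : TraceClass H, (X : H →L[ℂ] H).IsPositive → 0 ≤ f X) (u : K) :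
    CompletelyPositive (f.smulRight (pureState u)) := fun n X hX x => by
  -- With `a i = ⟪u, x i⟫`, the block form is `f` evaluated at `∑ conj (a i) * a j • X i j`. That
  -- operator is positive: test block positivity of `X` on the vectors `a i • y`.
  have e : ∑ i, ∑ j, ⟪x i, (f.smulRight (pureState u) (X i j) : K →L[ℂ] K) (x j)⟫_ℂ
      = f (∑ i, ∑ j, (⟪x i, u⟫_ℂ * ⟪u, x j⟫_ℂ) • X i j) := by
    simp only [map_sum, map_smul, LinearMap.smulRight_apply, Submodule.coe_smul, smul_apply,
      inner_smul_right, pureState, inner_rankOne_apply, smul_eq_mul]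
    exact Finset.sum_congr rfl fun i _ => Finset.sum_congr rfl fun j _ => mul_comm _ _
  rw [e]
  refine hf _ (isPositive_of_inner_nonneg fun y => ?_)
  convert hX fun i => ⟪u, x i⟫_ℂ • y using 1
  simp only [Submodule.coe_sum, Submodule.coe_smul, sum_apply, smul_apply, inner_sum,
    inner_smul_right, inner_smul_left, map_smul, inner_conj_symm]
  exact Finset.sum_congr rfl fun i _ => Finset.sum_congr rfl fun j _ => by ring

/-- A completely positive trace non-increasing map is dominated by a channel. -/
theorem exists_channel_ge [Nontrivial K] {Λ : TraceClass H →ₗ[ℂ] TraceClass K}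
    (hΛ : CompletelyPositive Λ)
    (hn : ∀ X : TraceClass H, (X : H →L[ℂ] H).IsPositive → traceNorm (Λ X) ≤ traceNorm X) :
    ∃ Φ : Channel H K, ∀ X : TraceClass H, (X : H →L[ℂ] H).IsPositive → ∀ x,
      (⟪x, (Λ X : K →L[ℂ] K) x⟫_ℂ).re ≤ (⟪x, (Φ X : K →L[ℂ] K) x⟫_ℂ).re := by
  obtain ⟨u, hu⟩ := exists_norm_eq K zero_le_one
  -- The trace defect is a positive functional, so placing it on the unit vector `u` adds a
  -- completely positive term.
  have hf : ∀ X : TraceClass H, (X : H →L[ℂ] H).IsPositive → 0 ≤ (traceₗ H - traceₗ K ∘ₗ Λ) X :=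
    fun X hX => by
      rw [LinearMap.sub_apply, LinearMap.comp_apply, traceₗ_apply, traceₗ_apply,
        trace_of_isPositive hX, trace_of_isPositive (hΛ.isPositive hX), sub_nonneg]
      exact_mod_cast hn X hX
  have hcp := completelyPositive_smulRight_pureState hf u
  refine ⟨⟨Λ + (traceₗ H - traceₗ K ∘ₗ Λ).smulRight (pureState u), fun n X hX x => ?_,
    fun X => ?_⟩, fun X hX x => ?_⟩
  · simp only [LinearMap.add_apply, Submodule.coe_add, add_apply, inner_add_right,
      Finset.sum_add_distrib]
    exact add_nonneg (hΛ n X hX x) (hcp n X hX x)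
  · rw [LinearMap.add_apply, LinearMap.smulRight_apply, trace_add, ← traceₗ_apply (_ • _), map_smul,
      traceₗ_apply, trace_pureState hu, LinearMap.sub_apply, LinearMap.comp_apply, traceₗ_apply,
      traceₗ_apply, smul_eq_mul, mul_one, add_sub_cancel]
  · rw [LinearMap.add_apply, Submodule.coe_add, add_apply, inner_add_right, Complex.add_re]
    exact le_add_of_nonneg_right (re_inner_apply_nonneg (hcp.isPositive hX) x)

end Completion

/-! ### Variational formula for the trace norm at trace zero -/

section TraceDistance

variable {H K : Type*} [NormedAddCommGroup H] [InnerProductSpace ℂ H] [CompleteSpace H]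
  [NormedAddCommGroup K] [InnerProductSpace ℂ K] [CompleteSpace K]

theorem re_inner_apply_le_posPart {A : H →L[ℂ] H} (hA : IsSelfAdjoint A) (x : H) :
    (⟪x, A x⟫_ℂ).re ≤ (⟪x, A⁺ x⟫_ℂ).re := by
  conv_lhs => rw [← CFC.posPart_sub_negPart A hA, sub_apply, inner_sub_right, Complex.sub_re]
  exact sub_le_self _ (re_inner_apply_nonneg (isPositive_negPart A) x)

/-- The spectral projection onto the positive part. -/
theorem exists_compression_eq_posPart {A : H →L[ℂ] H} (hA : IsSelfAdjoint A) :
    ∃ E : H →L[ℂ] H, ‖E‖ ≤ 1 ∧ ∀ x, ⟪E x, A (E x)⟫_ℂ = ⟪x, A⁺ x⟫_ℂ := by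
  set P := A⁺ with hP
  have hPs : ∀ x y, ⟪P x, y⟫_ℂ = ⟪x, P y⟫_ℂ := (isPositive_posPart A).isSelfAdjoint.isSymmetric
  -- The projection onto `M` serves as `E`: `A⁻` vanishes on `M` because `A⁻ A⁺ = 0`, and `A⁺`
  -- vanishes on the orthogonal complement of `M`.
  let M := (LinearMap.range (P : H →ₗ[ℂ] H)).topologicalClosure
  have : CompleteSpace M := (Submodule.isClosed_topologicalClosure _).completeSpace_coe
  have hPM : ∀ x, P x ∈ M := fun x => Submodule.le_topologicalClosure _ ⟨x, rfl⟩
  have hN : ∀ y ∈ M, A⁻ y = 0 := fun y hy => by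
    have : LinearMap.range (P : H →ₗ[ℂ] H) ≤ LinearMap.ker ((A⁻ : H →L[ℂ] H) : H →ₗ[ℂ] H) := by
      rintro _ ⟨x, rfl⟩
      exact congrArg (fun T : H →L[ℂ] H => T x) (CFC.negPart_mul_posPart A)
    exact Submodule.topologicalClosure_minimal _ this (A⁻).isClosed_ker hy
  refine ⟨M.starProjection, M.starProjection_norm_le, fun x => ?_⟩
  have hx : M.starProjection x ∈ M := M.starProjection_apply_mem x
  have h1 : P (M.starProjection x) = P x := by
    rw [← sub_eq_zero, ← map_sub]
    refine ext_inner_left ℂ fun y => ?_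
    rw [← hPs, inner_zero_right, ← neg_sub, inner_neg_right, neg_eq_zero]
    exact M.sub_starProjection_mem_orthogonal x _ (hPM y)
  have h2 : A (M.starProjection x) = P x := by
    conv_lhs => rw [← CFC.posPart_sub_negPart A hA, sub_apply, hN _ hx, sub_zero]
    exact h1
  rw [h2, ← h1, ← hPs, h1, hPs, h1]

/-- Replacing `S` by `S⁺` only increases the sum, conjugation by `C` does not increase `tr S⁺`, and
`tr S⁺` is half the trace norm. -/
theorem sum_re_inner_apply_le {S : TraceClass K} (hS : IsSelfAdjoint (S : K →L[ℂ] K))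
    (h0 : trace S = 0) {C : H →L[ℂ] K} (hC : ‖C‖ ≤ 1) (F : Finset (basisIndex H)) :
    ∑ i ∈ F, (⟪C (basis H i), (S : K →L[ℂ] K) (C (basis H i))⟫_ℂ).re ≤ traceNorm S / 2 := by
  have h : traceNorm S / 2 = traceNorm (posTC S hS) := by
    rw [traceNorm_eq_two_mul_posTC S hS h0]; ring
  rw [h]
  refine (Finset.sum_le_sum fun i _ => re_inner_apply_le_posPart hS _).trans ?_
  rw [← ENNReal.ofReal_le_ofReal_iff (traceNorm_nonneg _), ofReal_traceNorm,
    ENNReal.ofReal_sum_of_nonneg fun i _ => re_inner_apply_nonneg (isPositive_posPart _) _]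
  exact (ENNReal.sum_le_tsum F).trans (tsum_inner_apply_le (isPositive_posPart _) hC)

/-- Converse of `sum_re_inner_apply_le`: the projection onto the positive part attains `tr A⁺`.
Testing finite sums only is what lets the bound survive weak limits. -/
theorem traceNorm_le_of_sum_re_inner_apply_le {A : TraceClass H}
    (hA : IsSelfAdjoint (A : H →L[ℂ] H)) (h0 : trace A = 0) {c : ℝ}
    (h : ∀ (E : H →L[ℂ] H) (F : Finset (basisIndex H)), ‖E‖ ≤ 1 →
      ∑ i ∈ F, (⟪E (basis H i), (A : H →L[ℂ] H) (E (basis H i))⟫_ℂ).re ≤ c / 2) :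
    traceNorm A ≤ c := by
  obtain ⟨E, hE, hEA⟩ := exists_compression_eq_posPart hA
  -- The empty sum already forces `c` to be nonnegative.
  have hc : 0 ≤ c / 2 := by simpa using h E ∅ hE
  suffices h1 : traceNorm (posTC A hA) ≤ c / 2 by
    rw [traceNorm_eq_two_mul_posTC A hA h0]; linarith
  rw [← ENNReal.ofReal_le_ofReal_iff hc, ofReal_traceNorm,
    eTraceNorm_of_isPositive (T := (posTC A hA : H →L[ℂ] H)) (isPositive_posPart _)]
  refine ENNReal.summable.tsum_le_of_sum_le fun F => ?_
  rw [← ENNReal.ofReal_sum_of_nonneg fun i _ =>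
    re_inner_apply_nonneg (T := (posTC A hA : H →L[ℂ] H)) (isPositive_posPart _) _]
  refine ENNReal.ofReal_le_ofReal (le_trans (le_of_eq ?_) (h E F hE))
  exact Finset.sum_congr rfl fun i _ => by rw [hEA]; rfl

end TraceDistance

/-! ### The sequence space as decision space -/

section DecisionSpace

theorem exists_linearIsometry_l2 (K : Type v) [NormedAddCommGroup K] [InnerProductSpace ℂ K]
    [CompleteSpace K] [TopologicalSpace.SeparableSpace K] :
    Nonempty (K →ₗᵢ[ℂ] lp (fun _ : ULift.{w} ℕ => ℂ) 2) := by
  have hcount : Countable (basisIndex K) := by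
    -- Distinct basis vectors are at distance `√2`, so the balls of radius `1 / 2` are disjoint, and
    -- separability allows only countably many.
    refine Pairwise.countable_of_isOpen_disjoint
      (s := fun i => Metric.ball (basis K i) (1 / 2)) (fun i j hij => ?_)
      (fun i => Metric.isOpen_ball) fun i => Metric.nonempty_ball.2 (by norm_num)
    refine Metric.ball_disjoint_ball ?_
    have h := norm_sub_sq (𝕜 := ℂ) (basis K i) (basis K j)
    rw [(basis K).orthonormal.2 hij, (basis K).orthonormal.1, (basis K).orthonormal.1] at h
    rw [dist_eq_norm]
    norm_num at h ⊢
    nlinarith [norm_nonneg (basis K i - basis K j)]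
  obtain ⟨f, hf⟩ := exists_injective_nat (basisIndex K)
  let b : HilbertBasis (ULift.{w} ℕ) ℂ (lp (fun _ : ULift.{w} ℕ => ℂ) 2) :=
    HilbertBasis.ofRepr (LinearIsometryEquiv.refl ℂ _)
  -- Only an injection of index sets is used, so a finite-dimensional `K` is covered as well.
  have ho := (b.orthonormal.comp (fun i => ULift.up (f i))
    (ULift.up_injective.comp hf)).orthogonalFamily
  exact ⟨ho.linearIsometry.comp (basis K).repr.toLinearIsometry⟩

theorem separableSpace_l2 :
    TopologicalSpace.SeparableSpace (lp (fun _ : ULift.{w} ℕ => ℂ) 2) := by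
  let b : HilbertBasis (ULift.{w} ℕ) ℂ (lp (fun _ : ULift.{w} ℕ => ℂ) 2) :=
    HilbertBasis.ofRepr (LinearIsometryEquiv.refl ℂ _)
  rw [← TopologicalSpace.isSeparable_univ_iff]
  have h := ((Set.countable_range b).isSeparable.span (R := ℂ)).closure
  rwa [← Submodule.topologicalClosure_coe, b.dense_span] at h

theorem toENat_rank_l2 :
    Cardinal.toENat (Module.rank ℂ (lp (fun _ : ULift.{w} ℕ => ℂ) 2)) = ⊤ := by
  let b : HilbertBasis (ULift.{w} ℕ) ℂ (lp (fun _ : ULift.{w} ℕ => ℂ) 2) :=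
    HilbertBasis.ofRepr (LinearIsometryEquiv.refl ℂ _)
  rw [Cardinal.toENat_eq_top]
  refine le_trans ?_ b.orthonormal.linearIndependent.cardinal_le_rank
  exact Cardinal.aleph0_le_mk _

end DecisionSpace

/-! ### The two directions of the criterion -/

section Criterion

open Filter Topology

variable {Θ : Type t} {H : Type u} {K : Type v}
  [NormedAddCommGroup H] [InnerProductSpace ℂ H] [CompleteSpace H]
  [NormedAddCommGroup K] [InnerProductSpace ℂ K] [CompleteSpace K]

theorem isSelfAdjoint_sub {X Y : TraceClass H} (hX : (X : H →L[ℂ] H).IsPositive)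
    (hY : (Y : H →L[ℂ] H).IsPositive) : IsSelfAdjoint ((X - Y : TraceClass H) : H →L[ℂ] H) :=
  hX.isSelfAdjoint.sub hY.isSelfAdjoint

theorem qDeficient_of_channel {e : Θ → ℝ} {E : QuantumExperiment Θ H} {F : QuantumExperiment Θ K}
    (Λ : Channel H K) (hΛ : ∀ θ, traceNorm (Λ (E.state θ) - F.state θ) ≤ e θ) :
    QDeficient.{t, u, v, w} e E F := by
  intro HD _ _ _ _ _ L D
  refine iInf_le_of_le (D.comp Λ) (iSup_le fun θ => ?_)
  rw [← EReal.coe_zero, EReal.coe_le_coe_iff]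
  have hρ := Λ.completelyPositive.isPositive (E.nonneg θ)
  have h1 := L.lipschitz θ (D (Λ (E.state θ))) (D (F.state θ)) (D.completelyPositive.isPositive hρ)
    (D.completelyPositive.isPositive (F.nonneg θ))
    (by rw [D.tracePreserving, Λ.tracePreserving, E.trace_eq_one]; simp)
    (by rw [D.tracePreserving, F.trace_eq_one]; simp)
  rw [← map_sub] at h1
  have h2 := D.traceNorm_apply_le _ (isSelfAdjoint_sub hρ (F.nonneg θ))
  have h3 := (le_abs_self _).trans (h1.trans (h2.trans (hΛ θ)))
  change L.loss θ (D (Λ (E.state θ))) - _ - _ ≤ _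
  linarith

/-- The loss function given by the trace norm distance to a family of operators. -/
noncomputable def traceDistanceLoss (τ : Θ → TraceClass K) : LossFunction Θ K where
  loss θ X := traceNorm (X - τ θ)
  nonneg _ _ _ := traceNorm_nonneg _
  lipschitz θ X Y _ _ _ _ := by
    simpa using abs_traceNorm_sub_le (X - τ θ) (Y - τ θ)

/-- The loss is the trace distance to `D (F.state θ)`, so the term subtracted for `F` is zero. The
slack `ε` is there because the infimum over channels need not be attained. -/
theorem exists_channel_traceNorm_lt {e : Θ → ℝ} {E : QuantumExperiment Θ H}
    {F : QuantumExperiment Θ K} {G : Type w} [NormedAddCommGroup G] [InnerProductSpace ℂ G]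
    [CompleteSpace G] [TopologicalSpace.SeparableSpace G]
    (hG : Cardinal.toENat (Module.rank ℂ G) = ⊤) (h : QDeficient.{t, u, v, w} e E F)
    (D : Channel K G) {ε : ℝ} (hε : 0 < ε) :
    ∃ D' : Channel H G, ∀ θ, traceNorm (D (F.state θ) - D' (E.state θ)) ≤ e θ + ε := by
  have h1 := (h G hG (traceDistanceLoss fun θ => D (F.state θ)) D).trans_lt (EReal.coe_pos.2 hε)
  obtain ⟨D', hD'⟩ := iInf_lt_iff.1 h1
  refine ⟨D', fun θ => ?_⟩
  have h2 := (le_iSup _ θ).trans hD'.le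
  rw [EReal.coe_le_coe_iff] at h2
  simp only [traceDistanceLoss, sub_self, traceNorm_zero] at h2
  rw [← neg_sub, traceNorm_neg]
  linarith

theorem exists_channel_of_approx [Nontrivial K] {G : Type w} [NormedAddCommGroup G]
    [InnerProductSpace ℂ G] [CompleteSpace G] {e : Θ → ℝ} {E : QuantumExperiment Θ H}
    {F : QuantumExperiment Θ K} (V : K →ₗᵢ[ℂ] G)
    (h : ∀ ε > 0, ∃ D' : Channel H G, ∀ θ,
      traceNorm (isometryChannel V (F.state θ) - D' (E.state θ)) ≤ e θ + ε) :
    ∃ Λ : Channel H K, ∀ θ, traceNorm (Λ (E.state θ) - F.state θ) ≤ e θ := by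
  choose D hD using fun k : ℕ => h (1 / ((k : ℝ) + 1)) (by positivity)
  have hV : ‖V.toContinuousLinearMap‖ ≤ 1 := V.norm_toContinuousLinearMap_le
  have hV' : ‖ContinuousLinearMap.adjoint V.toContinuousLinearMap‖ ≤ 1 := by
    rwa [LinearIsometryEquiv.norm_map]
  -- Compression by `V†` brings the outputs back to `K`, at the price of losing the part outside the
  -- range of `V`.
  obtain ⟨Λ₀, hcp, hn, hlim⟩ := exists_tendsto_completelyPositive (hyperfilter ℕ)
    (fun k => conjₗ _ hV' ∘ₗ (D k).toLinearMap)
    (fun k => (completelyPositive_conjₗ hV').comp (D k).completelyPositive)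
    fun k X hX => (traceNorm_conjₗ_le hV' ((D k).completelyPositive.isPositive hX)).trans
      ((D k).traceNorm_apply_of_isPositive hX).le
  obtain ⟨Λ, hΛ⟩ := exists_channel_ge hcp hn
  refine ⟨Λ, fun θ => ?_⟩
  -- The sign matters: `Λ` dominates `Λ₀`, so upper bounds for `Λ₀` carry over to `F.state θ - Λ
  -- (E.state θ)` and not to its negative.
  rw [← neg_sub, traceNorm_neg]
  refine traceNorm_le_of_sum_re_inner_apply_le
    (isSelfAdjoint_sub (F.nonneg θ) (Λ.completelyPositive.isPositive (E.nonneg θ)))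
    (by rw [trace_sub, Λ.tracePreserving, E.trace_eq_one, F.trace_eq_one, sub_self])
    fun P I hP => ?_
  have hlim' : Tendsto (fun k => ∑ i ∈ I, (⟪V (P (basis K i)),
      ((isometryChannel V (F.state θ) - D k (E.state θ) : TraceClass G) : G →L[ℂ] G)
        (V (P (basis K i)))⟫_ℂ).re) (hyperfilter ℕ : Filter ℕ)
      (𝓝 (∑ i ∈ I, ((⟪P (basis K i), (F.state θ : K →L[ℂ] K) (P (basis K i))⟫_ℂ).re
        - (⟪P (basis K i), (Λ₀ (E.state θ) : K →L[ℂ] K) (P (basis K i))⟫_ℂ).re))) := by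
    refine tendsto_finsetSum I fun i _ => (((Complex.continuous_re.tendsto _).comp
      (hlim (E.state θ) (P (basis K i)) (P (basis K i)))).const_sub _).congr fun k => ?_
    rw [Submodule.coe_sub, sub_apply, inner_sub_right, inner_isometryChannel_apply, Complex.sub_re,
      Function.comp_apply, LinearMap.comp_apply, inner_conjₗ_apply,
      ContinuousLinearMap.adjoint_adjoint]
    rfl
  have he : Tendsto (fun k : ℕ => (e θ + 1 / ((k : ℝ) + 1)) / 2) (hyperfilter ℕ : Filter ℕ)
      (𝓝 (e θ / 2)) := by
    have := ((tendsto_one_div_add_atTop_nhds_zero_nat (𝕜 := ℝ)).const_add (e θ)).div_const 2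
    rw [add_zero] at this
    exact this.mono_left Nat.hyperfilter_le_atTop
  refine le_trans (Finset.sum_le_sum fun i _ => ?_)
    (le_of_tendsto_of_tendsto hlim' he (Eventually.of_forall fun k => ?_))
  · rw [Submodule.coe_sub, sub_apply, inner_sub_right, Complex.sub_re]
    exact sub_le_sub_left (hΛ _ (E.nonneg θ) _) _
  -- The test contraction `P` on `K` becomes the contraction `V P` into `G`, where the trace norm
  -- bound for `D k` is available.
  · have hC : ‖V.toContinuousLinearMap ∘L P‖ ≤ 1 :=
      (ContinuousLinearMap.opNorm_comp_le _ _).trans (mul_le_one₀ hV (norm_nonneg _) hP)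
    refine (sum_re_inner_apply_le (isSelfAdjoint_sub
      ((isometryChannel V).completelyPositive.isPositive (F.nonneg θ))
      ((D k).completelyPositive.isPositive (E.nonneg θ))) ?_ hC I).trans ?_
    · rw [trace_sub, (isometryChannel V).tracePreserving, (D k).tracePreserving, E.trace_eq_one,
        F.trace_eq_one, sub_self]
    · exact div_le_div_of_nonneg_right (hD k θ) zero_le_two

end Criterion

end QStat

theorem mainTheorem2 {Θ : Type t} {H : Type u} {K : Type v}
    [NormedAddCommGroup H] [InnerProductSpace ℂ H] [CompleteSpace H]
    [TopologicalSpace.SeparableSpace H]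
    [NormedAddCommGroup K] [InnerProductSpace ℂ K] [CompleteSpace K]
    [TopologicalSpace.SeparableSpace K] [Nontrivial K]
    (e : Θ → ℝ) (he : ∀ θ, 0 ≤ e θ)
    (E : QStat.QuantumExperiment Θ H) (F : QStat.QuantumExperiment Θ K) :
    QStat.QDeficient.{t, u, v, w} e E F ↔
      ∃ Λ : QStat.Channel H K,
        ∀ θ, QStat.traceNorm (Λ (E.state θ) - F.state θ) ≤ e θ := by
  refine ⟨fun h => ?_, fun ⟨Λ, hΛ⟩ => QStat.qDeficient_of_channel Λ hΛ⟩
  obtain ⟨V⟩ := QStat.exists_linearIsometry_l2.{v, w} K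
  have := QStat.separableSpace_l2.{w}
  exact QStat.exists_channel_of_approx V fun ε hε =>
    QStat.exists_channel_traceNorm_lt QStat.toENat_rank_l2 h (QStat.isometryChannel V) hε
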